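/- Let $\xi=(\xi_k)_{k\ge 0}$ be a sequence of independent, identically distributed random vectors in $\mathbf R^Z$ with common support $\Xi$, and consider the generalized plant $$x_{k+1}=A_{\rm o}(\xi_k)x_k+B_{{\rm o}w}(\xi_k)w_k+B_{{\rm o}u}(\xi_k)u_k,\qquad z_k=C_{\rm o}(\xi_k)x_k+D_{{\rm o}w}(\xi_k)w_k+D_{{\rm o}u}(\xi_k)u_k$$ with deterministic initial state $x_0$, where the coefficients are Borel functions on $\Xi$ with values in $\mathbf R^{n\times n}$, $\mathbf R^{n\times p_w}$, $\mathbf R^{n\times p_u}$, $\mathbf R^{q_z\times n}$, $\mathbf R^{q_z\times p_w}$, $\mathbf R^{q_z\times p_u}$, respectively, and the squares of all entries of $A_{\rm o}(\xi_0),B_{{\rm o}w}(\xi_0),B_{{\rm o}u}(\xi_0),C_{\rm o}(\xi_0),D_{{\rm o}w}(\xi_0),D_{{\rm o}u}(\xi_0)$ are integrable. For $F\in\mathbf R^{p_u\times n}$ let $G_F$ be the closed loop under $u_k=Fx_k$, i.e. the system $x_{k+1}=A(\xi_k)x_k+B(\xi_k)w_k$, $z_k=C(\xi_k)x_k+D(\xi_k)w_k$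 with $A=A_{\rm o}+B_{{\rm o}u}F$, $B=B_{{\rm o}w}$, $C=C_{\rm o}+D_{{\rm o}u}F$, $D=D_{{\rm o}w}$. It is exponentially stable in the second moment if there are $a>0$ and $\lambda\in(0,1)$ such that, for $w\equiv 0$, $\sqrt{E\|x_k\|^2}\le a\|x_0\|\lambda^k$ for all $k\ge 0$ and all $x_0\in\mathbf R^n$. Its $H_2$ norm is $\|G_F\|_2=\sqrt{\lim_{K\to\infty}s_K}$ (the limit exists if $G_F$ is exponentially stable in the second moment), where $$s_K=E\left[{\rm tr}\left(D(\xi_0)^TD(\xi_0)\right)\right]+\sum_{k=1}^K E\left[{\rm tr}\left(B(\xi_0)^T(\Phi_1^k)^TC(\xi_k)^TC(\xi_k)\Phi_1^kB(\xi_0)\right)\right],\qquad \Phi_1^k=A(\xi_{k-1})\cdots A(\xi_1),\ \ \Phi_1^1=I.$$ For a matrix $M$ with rows $M_1,\dots,M_m$ write ${\rm row}(M)=[M_1,\dots,M_m]$. Let $\bar G_{AB}\in\mathbf R^{\bar n_u\times (n+p_u)n}$, $\bar G_{CD}\in\mathbf R^{\bar q_{zu}\times(n+p_u)q_z}$ and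 $\bar B_{{\rm o}w}\in\mathbf R^{\bar p_w\times np_w}$, with $\bar n_u\le (n+p_u)n$, $\bar q_{zu}\le (n+p_u)q_z$, $\bar p_w\le np_w$, satisfy $$\bar G_{AB}^T\bar G_{AB}=E\big[[{\rm row}(A_{\rm o}(\xi_0)),{\rm row}(B_{{\rm o}u}(\xi_0))]^T[{\rm row}(A_{\rm o}(\xi_0)),{\rm row}(B_{{\rm o}u}(\xi_0))]\big],$$ $$\bar G_{CD}^T\bar G_{CD}=E\big[[{\rm row}(C_{\rm o}(\xi_0)),{\rm row}(D_{{\rm o}u}(\xi_0))]^T[{\rm row}(C_{\rm o}(\xi_0)),{\rm row}(D_{{\rm o}u}(\xi_0))]\big],$$ $$\bar B_{{\rm o}w}^T\bar B_{{\rm o}w}=E\big[{\rm row}(B_{{\rm o}w}(\xi_0))^T{\rm row}(B_{{\rm o}w}(\xi_0))\big];$$ such matrices exist. Partition $\bar G_{AB}=[\bar A_{{\rm o}1},\dots,\bar A_{{\rm o}n},\bar B_{{\rm o}u1},\dots,\bar B_{{\rm o}un}]$, $\bar G_{CD}=[\bar C_{{\rm o}1},\dots,\bar C_{{\rm o}q_z},\bar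 D_{{\rm o}u1},\dots,\bar D_{{\rm o}uq_z}]$ and $\bar B_{{\rm o}w}=[\bar B_{{\rm o}w1},\dots,\bar B_{{\rm o}wn}]$ into blocks, where the $\bar A_{{\rm o}i}$ and $\bar C_{{\rm o}i}$ have $n$ columns, the $\bar B_{{\rm o}ui}$ and $\bar D_{{\rm o}ui}$ have $p_u$ columns and the $\bar B_{{\rm o}wi}$ have $p_w$ columns, and let $\widetilde A_{\rm o}=[\bar A_{{\rm o}1}^T,\dots,\bar A_{{\rm o}n}^T]^T$, $\widetilde B_{{\rm o}u}=[\bar B_{{\rm o}u1}^T,\dots,\bar B_{{\rm o}un}^T]^T$, $\widetilde C_{\rm o}=[\bar C_{{\rm o}1}^T,\dots,\bar C_{{\rm o}q_z}^T]^T$, $\widetilde D_{{\rm o}u}=[\bar D_{{\rm o}u1}^T,\dots,\bar D_{{\rm o}uq_z}^T]^T$, $\widetilde B_{{\rm o}w}=[\bar B_{{\rm o}w1}^T,\dots,\bar B_{{\rm o}wn}^T]^T$. Let $E_D=E[D_{{\rm o}w}(\xi_0)^TD_{{\rm o}w}(\xi_0)]$. Then, for every $\gamma>0$, there exists a gain $F\in\mathbf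 R^{p_u\times n}$ such that $G_F$ is exponentially stable in the second moment and $\|G_F\|_2<\gamma$ if and only if there exist a symmetric positive definite $X\in\mathbf R^{n\times n}$, a matrix $Y\in\mathbf R^{p_u\times n}$ and a symmetric $R\in\mathbf R^{p_w\times p_w}$ satisfying $$\begin{bmatrix}X&(\widetilde A_{\rm o}X+\widetilde B_{{\rm o}u}Y)^T&(\widetilde C_{\rm o}X+\widetilde D_{{\rm o}u}Y)^T\\ \widetilde A_{\rm o}X+\widetilde B_{{\rm o}u}Y&X\otimes I_{\bar n_u}&0\\ \widetilde C_{\rm o}X+\widetilde D_{{\rm o}u}Y&0&I_{q_z\bar q_{zu}}\end{bmatrix}>0,\qquad \begin{bmatrix}R-E_D&\widetilde B_{{\rm o}w}^T\\ \widetilde B_{{\rm o}w}&X\otimes I_{\bar p_w}\end{bmatrix}>0,\qquad {\rm tr}(R)<\gamma^2,$$ where $>0$ means positive definite. Moreover, for every such $X,Y,R$ the matrix $F=YX^{-1}$ is such a gain. -/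

import Mathlib

open MeasureTheory ProbabilityTheory Filter
open scoped Matrix Kronecker Topology

noncomputable section

namespace IIDH2

/-- Entrywise expectation of a random matrix. -/
def expect {Ω ι κ : Type*} [MeasurableSpace Ω] (P : Measure Ω) (M : Ω → Matrix ι κ ℝ) :
    Matrix ι κ ℝ :=
  Matrix.of fun i j => ∫ ω, M ω i j ∂P

/-- A `Z`-dimensional discrete-time process of independent, identically distributed random
vectors. -/
structure IsIID {Ω : Type*} [MeasurableSpace Ω] {Z : ℕ} (P : Measure Ω)
    (ξ : ℕ → Ω → EuclideanSpace ℝ (Fin Z)) : Prop where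
  measurable : ∀ k, Measurable (ξ k)
  indep : iIndepFun ξ P
  identDistrib : ∀ k, IdentDistrib (ξ k) (ξ 0) P P

/-- A matrix-valued Borel function on the support `Ξ` of (the law of) the random vector `ξ₀`.
It is represented by a function on the whole space, whose values outside `Ξ` are irrelevant. -/
def IsBorelOnSupport {Ω ι κ : Type*} [MeasurableSpace Ω] {Z : ℕ} (P : Measure Ω)
    (ξ₀ : Ω → EuclideanSpace ℝ (Fin Z)) (M : EuclideanSpace ℝ (Fin Z) → Matrix ι κ ℝ) : Prop :=
  ∀ i j, Measurable fun x : (P.map ξ₀).support => M x i j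

/-- The squares of the entries of the random matrix `M(ξ₀)` are integrable. -/
def SqIntegrable {Ω ι κ : Type*} [MeasurableSpace Ω] {Z : ℕ} (P : Measure Ω)
    (ξ₀ : Ω → EuclideanSpace ℝ (Fin Z)) (M : EuclideanSpace ℝ (Fin Z) → Matrix ι κ ℝ) : Prop :=
  ∀ i j, Integrable (fun ω => M (ξ₀ ω) i j ^ 2) P

/-! ### Systems without control input -/

/-- Coefficients of the system `x_{k+1} = A(ξ_k) x_k + B(ξ_k) w_k`,
`z_k = C(ξ_k) x_k + D(ξ_k) w_k`. -/
structure LinSys (Z n p q : ℕ) where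
  A : EuclideanSpace ℝ (Fin Z) → Matrix (Fin n) (Fin n) ℝ
  B : EuclideanSpace ℝ (Fin Z) → Matrix (Fin n) (Fin p) ℝ
  C : EuclideanSpace ℝ (Fin Z) → Matrix (Fin q) (Fin n) ℝ
  D : EuclideanSpace ℝ (Fin Z) → Matrix (Fin q) (Fin p) ℝ

namespace LinSys

variable {Ω : Type*} {Z n p q : ℕ}

/-- The state process `x_k` with deterministic initial state `x0` and input process `w`. -/
def state (G : LinSys Z n p q) (ξ : ℕ → Ω → EuclideanSpace ℝ (Fin Z))
    (w : ℕ → Ω → EuclideanSpace ℝ (Fin p)) (x0 : EuclideanSpace ℝ (Fin n)) :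
    ℕ → Ω → EuclideanSpace ℝ (Fin n)
  | 0, _ => x0
  | k + 1, ω => WithLp.toLp 2
      (G.A (ξ k ω) *ᵥ (G.state ξ w x0 k ω).ofLp + G.B (ξ k ω) *ᵥ (w k ω).ofLp)

/-- Exponential stability in the second moment:
for `w ≡ 0`, `√(E‖x_k‖²) ≤ a ‖x₀‖ lam ^ k` for all `k` and `x₀`. -/
def ExpStable [MeasurableSpace Ω] (G : LinSys Z n p q) (P : Measure Ω)
    (ξ : ℕ → Ω → EuclideanSpace ℝ (Fin Z)) : Prop :=
  ∃ a : ℝ, 0 < a ∧ ∃ lam ∈ Set.Ioo (0 : ℝ) 1, ∀ (k : ℕ) (x0 : EuclideanSpace ℝ (Fin n)),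
    √(∫ ω, ‖G.state ξ 0 x0 k ω‖ ^ 2 ∂P) ≤ a * ‖x0‖ * lam ^ k

/-- The transition matrix `Φ_{k₁}^{k₂} = A(ξ_{k₂-1}) ⋯ A(ξ_{k₁})` for `k₁ < k₂`, and the identity
for `k₂ = k₁` (the identity, too, for `k₂ < k₁`, which is never used). -/
def transition (G : LinSys Z n p q) (ξ : ℕ → Ω → EuclideanSpace ℝ (Fin Z)) (k₁ : ℕ) :
    ℕ → Ω → Matrix (Fin n) (Fin n) ℝ
  | 0, _ => 1
  | k + 1, ω => if k < k₁ then 1 else G.A (ξ k ω) * G.transition ξ k₁ k ω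

/-- The expected square sum `s_K` of the impulse response on the times `0, …, K`. -/
def impulseSum [MeasurableSpace Ω] (G : LinSys Z n p q) (P : Measure Ω)
    (ξ : ℕ → Ω → EuclideanSpace ℝ (Fin Z)) (K : ℕ) : ℝ :=
  (∫ ω, ((G.D (ξ 0 ω))ᵀ * G.D (ξ 0 ω)).trace ∂P) +
    ∑ k ∈ Finset.Icc 1 K,
      ∫ ω, ((G.B (ξ 0 ω))ᵀ * (G.transition ξ 1 k ω)ᵀ * (G.C (ξ k ω))ᵀ * G.C (ξ k ω) *
        G.transition ξ 1 k ω * G.B (ξ 0 ω)).trace ∂P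

/-- `v` is the `H₂` norm of the system: `s_K` converges to some `s_∞`, and `v = √s_∞`. -/
def HasH2Norm [MeasurableSpace Ω] (G : LinSys Z n p q) (P : Measure Ω)
    (ξ : ℕ → Ω → EuclideanSpace ℝ (Fin Z)) (v : ℝ) : Prop :=
  ∃ s : ℝ, Tendsto (G.impulseSum P ξ) atTop (𝓝 s) ∧ v = √s

end LinSys

/-! ### Generalized plants and state feedback -/

/-- Coefficients of the generalized plant
`x_{k+1} = A(ξ_k) x_k + Bw(ξ_k) w_k + Bu(ξ_k) u_k`,
`z_k = C(ξ_k) x_k + Dw(ξ_k) w_k + Du(ξ_k) u_k`. -/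
structure Plant (Z n pw pu qz : ℕ) where
  A : EuclideanSpace ℝ (Fin Z) → Matrix (Fin n) (Fin n) ℝ
  Bw : EuclideanSpace ℝ (Fin Z) → Matrix (Fin n) (Fin pw) ℝ
  Bu : EuclideanSpace ℝ (Fin Z) → Matrix (Fin n) (Fin pu) ℝ
  C : EuclideanSpace ℝ (Fin Z) → Matrix (Fin qz) (Fin n) ℝ
  Dw : EuclideanSpace ℝ (Fin Z) → Matrix (Fin qz) (Fin pw) ℝ
  Du : EuclideanSpace ℝ (Fin Z) → Matrix (Fin qz) (Fin pu) ℝ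

/-- A factor `Gbar` with `Gbarᵀ Gbar = E[vᵀ v]` for the random row vector `v`, having at most as
many rows as columns. -/
def IsFactor {Ω ι : Type*} [MeasurableSpace Ω] [Fintype ι] (P : Measure Ω) {m : ℕ}
    (v : Ω → ι → ℝ) (Gbar : Matrix (Fin m) ι ℝ) : Prop :=
  m ≤ Fintype.card ι ∧ Gbarᵀ * Gbar = expect P fun ω => Matrix.vecMulVec (v ω) (v ω)

/-- The row vector `row(M)`, i.e. the rows of `M` side by side, its entries indexed by the pairs
(number of the row, position in the row). -/
def row {m l : ℕ} (M : Matrix (Fin m) (Fin l) ℝ) : Fin m × Fin l → ℝ := fun ij => M ij.1 ij.2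

/-- For `Gbar = [Gbar₁, …, Gbarₘ]`, a row of `m` blocks of size `r × l`, the column
`[Gbar₁ᵀ, …, Gbarₘᵀ]ᵀ` of these blocks. -/
def restack {m l r : ℕ} (Gbar : Matrix (Fin r) (Fin m × Fin l) ℝ) :
    Matrix (Fin m × Fin r) (Fin l) ℝ :=
  Matrix.of fun ia j => Gbar ia.2 (ia.1, j)

namespace Plant

variable {Ω : Type*} [MeasurableSpace Ω] {Z n pw pu qz : ℕ}

/-- All coefficients are Borel on the support of `ξ_0`, and their entries at `ξ_0` are
square integrable. -/
structure Admissible (G : Plant Z n pw pu qz) (P : Measure Ω)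
    (ξ : ℕ → Ω → EuclideanSpace ℝ (Fin Z)) : Prop where
  borel_A : IsBorelOnSupport P (ξ 0) G.A
  borel_Bw : IsBorelOnSupport P (ξ 0) G.Bw
  borel_Bu : IsBorelOnSupport P (ξ 0) G.Bu
  borel_C : IsBorelOnSupport P (ξ 0) G.C
  borel_Dw : IsBorelOnSupport P (ξ 0) G.Dw
  borel_Du : IsBorelOnSupport P (ξ 0) G.Du
  sq_A : SqIntegrable P (ξ 0) G.A
  sq_Bw : SqIntegrable P (ξ 0) G.Bw
  sq_Bu : SqIntegrable P (ξ 0) G.Bu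
  sq_C : SqIntegrable P (ξ 0) G.C
  sq_Dw : SqIntegrable P (ξ 0) G.Dw
  sq_Du : SqIntegrable P (ξ 0) G.Du

/-- The closed loop `G_F` under the state feedback `u_k = F x_k`. -/
def closedLoop (G : Plant Z n pw pu qz) (F : Matrix (Fin pu) (Fin n) ℝ) : LinSys Z n pw qz where
  A x := G.A x + G.Bu x * F
  B x := G.Bw x
  C x := G.C x + G.Du x * F
  D x := G.Dw x

/-- `F` makes the closed loop exponentially stable in the second moment, with `‖G_F‖₂ < γ`. -/
def IsGoodGain (G : Plant Z n pw pu qz) (P : Measure Ω)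
    (ξ : ℕ → Ω → EuclideanSpace ℝ (Fin Z)) (γ : ℝ) (F : Matrix (Fin pu) (Fin n) ℝ) : Prop :=
  (G.closedLoop F).ExpStable P ξ ∧ ∃ v, (G.closedLoop F).HasH2Norm P ξ v ∧ v < γ

/-- Factors of the second-moment matrices of `[row(A), row(Bu)]`, `[row(C), row(Du)]` and
`row(Bw)`, all taken at `ξ_0`. -/
structure Factors (G : Plant Z n pw pu qz) (P : Measure Ω)
    (ξ : ℕ → Ω → EuclideanSpace ℝ (Fin Z)) where
  nu : ℕ
  qzu : ℕ
  pwBar : ℕ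
  GAB : Matrix (Fin nu) ((Fin n × Fin n) ⊕ (Fin n × Fin pu)) ℝ
  GCD : Matrix (Fin qzu) ((Fin qz × Fin n) ⊕ (Fin qz × Fin pu)) ℝ
  BwBar : Matrix (Fin pwBar) (Fin n × Fin pw) ℝ
  isFactor_GAB :
    IsFactor P (fun ω => Sum.elim (row (G.A (ξ 0 ω))) (row (G.Bu (ξ 0 ω)))) GAB
  isFactor_GCD :
    IsFactor P (fun ω => Sum.elim (row (G.C (ξ 0 ω))) (row (G.Du (ξ 0 ω)))) GCD
  isFactor_BwBar : IsFactor P (fun ω => row (G.Bw (ξ 0 ω))) BwBar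

/-- The matrix `E_D = E[Dw(ξ_0)ᵀ Dw(ξ_0)]`. -/
def ED (G : Plant Z n pw pu qz) (P : Measure Ω) (ξ : ℕ → Ω → EuclideanSpace ℝ (Fin Z)) :
    Matrix (Fin pw) (Fin pw) ℝ :=
  expect P fun ω => (G.Dw (ξ 0 ω))ᵀ * G.Dw (ξ 0 ω)

namespace Factors

variable {G : Plant Z n pw pu qz} {P : Measure Ω} {ξ : ℕ → Ω → EuclideanSpace ℝ (Fin Z)}

def ATilde (φ : G.Factors P ξ) : Matrix (Fin n × Fin φ.nu) (Fin n) ℝ := restack φ.GAB.toCols₁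

def BuTilde (φ : G.Factors P ξ) : Matrix (Fin n × Fin φ.nu) (Fin pu) ℝ := restack φ.GAB.toCols₂

def CTilde (φ : G.Factors P ξ) : Matrix (Fin qz × Fin φ.qzu) (Fin n) ℝ := restack φ.GCD.toCols₁

def DuTilde (φ : G.Factors P ξ) : Matrix (Fin qz × Fin φ.qzu) (Fin pu) ℝ := restack φ.GCD.toCols₂

def BwTilde (φ : G.Factors P ξ) : Matrix (Fin n × Fin φ.pwBar) (Fin pw) ℝ := restack φ.BwBar

/-- `(X, Y, R)` solves the linear matrix inequalities for the level `γ`. -/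
structure SolvesLMI (φ : G.Factors P ξ) (γ : ℝ) (X : Matrix (Fin n) (Fin n) ℝ)
    (Y : Matrix (Fin pu) (Fin n) ℝ) (R : Matrix (Fin pw) (Fin pw) ℝ) : Prop where
  posDef_X : X.PosDef
  symm_R : R.IsSymm
  block₁ : (Matrix.fromBlocks
      X
      (Matrix.fromCols (φ.ATilde * X + φ.BuTilde * Y)ᵀ (φ.CTilde * X + φ.DuTilde * Y)ᵀ)
      (Matrix.fromRows (φ.ATilde * X + φ.BuTilde * Y) (φ.CTilde * X + φ.DuTilde * Y))
      (Matrix.fromBlocks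
        (X ⊗ₖ (1 : Matrix (Fin φ.nu) (Fin φ.nu) ℝ)) 0
        0 (1 : Matrix (Fin qz × Fin φ.qzu) (Fin qz × Fin φ.qzu) ℝ))).PosDef
  block₂ : (Matrix.fromBlocks
      (R - G.ED P ξ) φ.BwTildeᵀ
      φ.BwTilde (X ⊗ₖ (1 : Matrix (Fin φ.pwBar) (Fin φ.pwBar) ℝ))).PosDef
  trace_R : R.trace < γ ^ 2

end Factors

end Plant

end IIDH2

end

noncomputable section

namespace IIDH2

/-! ### Positive linear maps on matrices and Lyapunov inequalities -/

section LinearAlgebra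

open scoped MatrixOrder

/-! For a fixed gain, write `L S = E[Aᵀ S A]`, `Q = E[Cᵀ C]`, `T S = E[Bᵀ S B]` for the closed loop.
`L` and `T` are linear and preserve the Loewner order. Since each coefficient is independent of the
earlier ones, second moments propagate by powers of `L`: `E‖x_k‖² = x₀ᵀ L^k(1) x₀`, and `s_K =
tr(E_D + T(∑_{k<K} L^k Q))`. The random system thus becomes a deterministic question about one
positive map.

Stability means geometric decay of `L^k 1`. Stability together with `‖G_F‖₂ < γ` is equivalent to
the existence of `V > 0` with `V - L V - Q > 0` and `tr(E_D + T V) < γ²`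
(`LinSys.expStable_and_h2Norm_lt_iff`): such a `V` dominates every partial sum and forces decay,
while conversely a long partial sum with `Q` slightly enlarged is such a `V`.

With `X = V⁻¹` and `Y = F X`, Schur complements and a congruence by `X` turn these inequalities into
the LMIs, `R` being a strict upper bound of `E_D + T V`. The factors enter only through second
moments of entries, which is all that `L`, `Q` and `T` depend on (`restack_feedback`,
`restack_kronecker`). -/

theorem posDef_of_smul_one_le {ι : Type*} [Finite ι] [DecidableEq ι] {A : Matrix ι ι ℝ}
    {δ : ℝ} (hδ : 0 < δ) (h : δ • 1 ≤ A) :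
    A.PosDef := by
  have := Fintype.ofFinite ι
  have := (Matrix.PosDef.one (n := ι) (R := ℝ)).smul hδ |>.add_posSemidef (Matrix.le_iff.1 h)
  simpa using this

theorem monotone_of_map_nonneg {ι κ : Type*} {T : Matrix ι ι ℝ →ₗ[ℝ] Matrix κ κ ℝ}
    (hT : ∀ S, 0 ≤ S → 0 ≤ T S) : Monotone T := fun S S' h => by
  have := hT _ (sub_nonneg.2 h)
  rwa [map_sub, sub_nonneg] at this

theorem pow_map_nonneg {ι : Type*} {L : Matrix ι ι ℝ →ₗ[ℝ] Matrix ι ι ℝ}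
    (hL : ∀ S, 0 ≤ S → 0 ≤ L S) (k : ℕ) :
    ∀ S, 0 ≤ S → 0 ≤ (L ^ k) S := by
  induction k with
  | zero => simp
  | succ k ih =>
    intro S hS
    rw [pow_succ', Module.End.mul_apply]
    exact hL _ (ih S hS)

/-- Induction: the sum of `N + 1` terms is `L` of the sum of `N` terms plus `Q`, hence at most `L V
+ Q ≤ V`. -/
theorem sum_pow_le_of_lyapunov {ι : Type*} {L : Matrix ι ι ℝ →ₗ[ℝ] Matrix ι ι ℝ}
    (hL : ∀ S, 0 ≤ S → 0 ≤ L S) {V Q : Matrix ι ι ℝ}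
    (hV : 0 ≤ V) (h : L V + Q ≤ V) (N : ℕ) : ∑ k ∈ Finset.range N, (L ^ k) Q ≤ V := by
  induction N with
  | zero => simpa
  | succ N ih =>
    rw [Finset.sum_range_succ']
    refine le_trans ?_ h
    have : ∑ k ∈ Finset.range N, (L ^ (k + 1)) Q = L (∑ k ∈ Finset.range N, (L ^ k) Q) := by
      simp [map_sum, pow_succ']
    rw [this]
    simpa using monotone_of_map_nonneg hL ih

variable {ι κ : Type*} [Fintype ι] [Fintype κ] [DecidableEq ι] [DecidableEq κ]

/-- Positive definite means semidefinite and invertible; for invertible `D` both properties pass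
between the block matrix and its Schur complement. -/
theorem posDef_fromBlocks_iff_schur (A : Matrix ι ι ℝ) (C : Matrix κ ι ℝ) {D : Matrix κ κ ℝ}
    (hD : D.PosDef) :
    (Matrix.fromBlocks A Cᵀ C D).PosDef ↔ (A - Cᵀ * D⁻¹ * C).PosDef := by
  have : Invertible D := hD.isUnit.invertible
  have h1 : (Matrix.fromBlocks A Cᵀ C D).PosSemidef ↔ (A - Cᵀ * D⁻¹ * C).PosSemidef := by
    simpa using Matrix.PosDef.fromBlocks₂₂ A Cᵀ hD
  have h2 : IsUnit (Matrix.fromBlocks A Cᵀ C D) ↔ IsUnit (A - Cᵀ * D⁻¹ * C) := by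
    rw [Matrix.isUnit_fromBlocks_iff_of_invertible₂₂, Matrix.invOf_eq_nonsing_inv]
  constructor
  · intro h
    exact (h1.1 h.posSemidef).posDef_iff_isUnit.2 (h2.1 h.isUnit)
  · intro h
    exact (h1.2 h.posSemidef).posDef_iff_isUnit.2 (h2.2 h.isUnit)

theorem smul_one_dotProduct (c : ℝ) (x : ι → ℝ) :
    x ⬝ᵥ ((c • (1 : Matrix ι ι ℝ)) *ᵥ x) = c * (x ⬝ᵥ x) := by
  simp [Matrix.smul_mulVec]

theorem exists_le_smul_one {A : Matrix ι ι ℝ} (hA : A.IsHermitian) :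
    ∃ c : ℝ, 0 < c ∧ A ≤ c • 1 := by
  refine ⟨(∑ i, ∑ j, |A i j|) + 1, by positivity, ?_⟩
  rw [Matrix.le_iff, Matrix.posSemidef_iff_dotProduct_mulVec]
  refine ⟨(Matrix.isHermitian_one.smul (IsSelfAdjoint.all _)).sub hA, fun x => ?_⟩
  rw [star_trivial, Matrix.sub_mulVec, dotProduct_sub, smul_one_dotProduct]
  have hx : ∀ i, x i ^ 2 ≤ x ⬝ᵥ x := fun i => by
    rw [dotProduct, sq]
    exact Finset.single_le_sum (f := fun i => x i * x i) (fun i _ => mul_self_nonneg _)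
      (Finset.mem_univ i)
  have h0 : 0 ≤ x ⬝ᵥ x := by simpa using dotProduct_star_self_nonneg x
  have h1 : x ⬝ᵥ (A *ᵥ x) = ∑ i, ∑ j, x i * (A i j * x j) := by
    simp only [dotProduct, Matrix.mulVec, Finset.mul_sum]
  have : x ⬝ᵥ (A *ᵥ x) ≤ (∑ i, ∑ j, |A i j|) * (x ⬝ᵥ x) := by
    rw [h1, Finset.sum_mul]
    simp only [Finset.sum_mul]
    refine Finset.sum_le_sum fun i _ => Finset.sum_le_sum fun j _ => ?_
    have h1 : |x i * x j| ≤ x ⬝ᵥ x := by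
      rw [abs_le]
      constructor <;> nlinarith [hx i, hx j, sq_nonneg (x i + x j), sq_nonneg (x i - x j)]
    calc x i * (A i j * x j) = A i j * (x i * x j) := by ring
      _ ≤ |A i j * (x i * x j)| := le_abs_self _
      _ = |A i j| * |x i * x j| := abs_mul _ _
      _ ≤ _ := mul_le_mul_of_nonneg_left h1 (abs_nonneg _)
  linarith

/-- From `A⁻¹ ≤ c • 1`: the block matrix with diagonal `c • 1`, `A` and off-diagonal `1` is
semidefinite, and eliminating the other corner gives `c⁻¹ • 1 ≤ A`. -/
theorem exists_smul_one_le {A : Matrix ι ι ℝ} (hA : A.PosDef) :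
    ∃ δ : ℝ, 0 < δ ∧ δ • 1 ≤ A := by
  obtain ⟨c, hc, h⟩ := exists_le_smul_one hA.inv.isHermitian
  refine ⟨c⁻¹, inv_pos.2 hc, ?_⟩
  have : Invertible A := hA.isUnit.invertible
  have hc1 : (c • (1 : Matrix ι ι ℝ)).PosDef := Matrix.PosDef.one.smul hc
  rw [Matrix.le_iff] at h ⊢
  have h1 := (Matrix.PosDef.fromBlocks₂₂ (c • 1) (1 : Matrix ι ι ℝ) hA).2 (by simpa using h)
  have : Invertible (c • (1 : Matrix ι ι ℝ)) := hc1.isUnit.invertible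
  have h2 := (Matrix.PosDef.fromBlocks₁₁ (1 : Matrix ι ι ℝ) A hc1).1 h1
  have h3 : (c • (1 : Matrix ι ι ℝ))⁻¹ = c⁻¹ • 1 :=
    Matrix.inv_eq_right_inv (by simp [smul_smul, hc.ne'])
  simpa [h3] using h2

variable {L : Matrix ι ι ℝ →ₗ[ℝ] Matrix ι ι ℝ}

/-- The gap `V - L V` dominates a multiple of `V`, so `L V ≤ r • V` with `r < 1`. Iterate, then
compare `V` with the identity on both sides. -/
theorem exists_pow_le_of_lyapunov (hL : ∀ S, 0 ≤ S → 0 ≤ L S) {V : Matrix ι ι ℝ}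
    (hV : V.PosDef) (hLV : (V - L V).PosDef) :
    ∃ c : ℝ, 0 < c ∧ ∃ r ∈ Set.Ioo (0 : ℝ) 1, ∀ k, (L ^ k) 1 ≤ (c * r ^ k) • 1 := by
  obtain ⟨δ, hδ, h1⟩ := exists_smul_one_le hLV
  obtain ⟨α, hα, h2⟩ := exists_smul_one_le hV
  obtain ⟨β, hβ, h3⟩ := exists_le_smul_one hV.isHermitian
  have h1' : (0 : Matrix ι ι ℝ) ≤ 1 := Matrix.PosSemidef.one.nonneg
  -- The upper bound is enlarged beyond `δ` so that `r = 1 - δ / b` is strictly positive.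
  obtain ⟨b, hb, hb', h4⟩ : ∃ b : ℝ, 0 < b ∧ δ < b ∧ V ≤ b • 1 :=
    ⟨β + δ, by positivity, by linarith, h3.trans (smul_le_smul_of_nonneg_right (by linarith) h1')⟩
  set r := 1 - δ / b with hr
  have hr0 : 0 < r := by rw [hr, sub_pos, div_lt_one hb]; exact hb'
  have hr1 : r < 1 := by rw [hr]; linarith [div_pos hδ hb]
  have h5 : L V ≤ r • V := by
    have : (δ / b) • V ≤ V - L V := by
      refine le_trans ?_ h1
      calc (δ / b) • V ≤ (δ / b) • (b • (1 : Matrix ι ι ℝ)) :=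
            smul_le_smul_of_nonneg_left h4 (by positivity)
        _ = δ • 1 := by rw [smul_smul, div_mul_cancel₀ _ hb.ne']
    rw [hr, sub_smul, one_smul]
    exact le_sub_comm.1 this
  have h6 : ∀ k, (L ^ k) V ≤ r ^ k • V := by
    intro k
    induction k with
    | zero => simp
    | succ k ih =>
      rw [pow_succ', Module.End.mul_apply]
      calc L ((L ^ k) V) ≤ L (r ^ k • V) := monotone_of_map_nonneg hL ih
        _ = r ^ k • L V := map_smul _ _ _
        _ ≤ r ^ k • r • V := smul_le_smul_of_nonneg_left h5 (by positivity)
        _ = _ := by rw [smul_smul, pow_succ]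
  refine ⟨α⁻¹ * b, by positivity, r, ⟨hr0, hr1⟩, fun k => ?_⟩
  have h7 : (1 : Matrix ι ι ℝ) ≤ α⁻¹ • V := by
    have := smul_le_smul_of_nonneg_left h2 (inv_pos.2 hα).le
    rwa [smul_smul, inv_mul_cancel₀ hα.ne', one_smul] at this
  calc (L ^ k) 1 ≤ (L ^ k) (α⁻¹ • V) := monotone_of_map_nonneg (pow_map_nonneg hL k) h7
    _ = α⁻¹ • (L ^ k) V := map_smul _ _ _
    _ ≤ α⁻¹ • r ^ k • b • (1 : Matrix ι ι ℝ) :=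
      smul_le_smul_of_nonneg_left ((h6 k).trans
        (smul_le_smul_of_nonneg_left h4 (by positivity))) (by positivity)
    _ = _ := by rw [smul_smul, smul_smul]; congr 1; ring

/-- `V` is a truncated series `∑ L^k (Q + ε • 1)`. It telescopes to `V - L V - Q = ε • 1 - L^(N+1)
W`, with `W = Q + ε • 1`, which stays positive once the tail is below `ε / 2`; no infinite series of
matrices is needed. The last bound measures the cost of `ε`. -/
theorem exists_lyapunov_of_pow_le (hL : ∀ S, 0 ≤ S → 0 ≤ L S) {c r : ℝ} (hc : 0 < c)
    (hr : r ∈ Set.Ioo (0 : ℝ) 1) (h : ∀ k, (L ^ k) 1 ≤ (c * r ^ k) • 1) {Q : Matrix ι ι ℝ}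
    (hQ : 0 ≤ Q) {ε : ℝ} (hε : 0 < ε) :
    ∃ (N : ℕ) (V : Matrix ι ι ℝ), V.PosDef ∧ (V - L V - Q).PosDef ∧
      V ≤ ∑ k ∈ Finset.range N, (L ^ k) Q + (ε * (c / (1 - r))) • 1 := by
  have h1' : (0 : Matrix ι ι ℝ) ≤ 1 := Matrix.PosSemidef.one.nonneg
  have hW : 0 ≤ Q + ε • (1 : Matrix ι ι ℝ) := add_nonneg hQ (smul_nonneg hε.le h1')
  obtain ⟨d, hd, hd'⟩ := exists_le_smul_one (Matrix.nonneg_iff_posSemidef.1 hW).isHermitian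
  obtain ⟨N, hN⟩ : ∃ N : ℕ, d * (c * r ^ (N + 1)) < ε / 2 := by
    obtain ⟨N, hN⟩ := exists_pow_lt_of_lt_one (show 0 < ε / 2 / (d * c) by positivity) hr.2
    refine ⟨N, ?_⟩
    rw [lt_div_iff₀ (by positivity)] at hN
    have : r ^ (N + 1) ≤ r ^ N := pow_le_pow_of_le_one hr.1.le hr.2.le (Nat.le_succ N)
    calc d * (c * r ^ (N + 1)) ≤ d * (c * r ^ N) := by gcongr
      _ = r ^ N * (d * c) := by ring
      _ < _ := hN
  set W := Q + ε • (1 : Matrix ι ι ℝ) with hWdef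
  set V := ∑ k ∈ Finset.range (N + 1), (L ^ k) W with hV
  have hLV : L V = V + (L ^ (N + 1)) W - W := by
    have e1 : L V = ∑ k ∈ Finset.range (N + 1), (L ^ (k + 1)) W := by
      simp [hV, map_sum, pow_succ']
    have e2 := Finset.sum_range_succ' (fun k => (L ^ k) W) (N + 1)
    rw [Finset.sum_range_succ, ← hV, ← e1] at e2
    simp only [pow_zero, Module.End.one_apply] at e2
    rw [e2, add_sub_cancel_right]
  refine ⟨N + 1, V, ?_, ?_, ?_⟩
  · refine posDef_of_smul_one_le hε ?_
    rw [hV, Finset.sum_range_succ']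
    calc ε • (1 : Matrix ι ι ℝ) ≤ W := le_add_of_nonneg_left hQ
      _ = (L ^ 0) W := by simp
      _ ≤ _ := le_add_of_nonneg_left (Finset.sum_nonneg fun k _ => pow_map_nonneg hL _ _ hW)
  · refine posDef_of_smul_one_le (half_pos hε) ?_
    have : (L ^ (N + 1)) W ≤ (ε / 2) • 1 :=
      calc (L ^ (N + 1)) W ≤ (L ^ (N + 1)) (d • 1) :=
            monotone_of_map_nonneg (pow_map_nonneg hL _) hd'
        _ = d • (L ^ (N + 1)) 1 := map_smul _ _ _
        _ ≤ d • (c * r ^ (N + 1)) • (1 : Matrix ι ι ℝ) :=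
          smul_le_smul_of_nonneg_left (h _) hd.le
        _ = (d * (c * r ^ (N + 1))) • 1 := smul_smul _ _ _
        _ ≤ _ := smul_le_smul_of_nonneg_right hN.le h1'
    have e : V - L V - Q = ε • (1 : Matrix ι ι ℝ) - (L ^ (N + 1)) W := by
      rw [hLV, hWdef]; abel
    rw [e, le_sub_comm]
    refine this.trans_eq ?_
    rw [← sub_smul]; congr 1; ring
  · have e : V = ∑ k ∈ Finset.range (N + 1), (L ^ k) Q
        + ε • ∑ k ∈ Finset.range (N + 1), (L ^ k) 1 := by
      simp [hV, hWdef, Finset.sum_add_distrib, Finset.smul_sum]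
    rw [e, mul_smul]
    refine add_le_add_right (smul_le_smul_of_nonneg_left ?_ hε.le) _
    calc ∑ k ∈ Finset.range (N + 1), (L ^ k) (1 : Matrix ι ι ℝ)
        ≤ ∑ k ∈ Finset.range (N + 1), (c * r ^ k) • (1 : Matrix ι ι ℝ) :=
          Finset.sum_le_sum fun k _ => h k
      _ = (c * ∑ k ∈ Finset.range (N + 1), r ^ k) • 1 := by
          rw [← Finset.sum_smul, Finset.mul_sum]
      _ ≤ _ := by
          refine smul_le_smul_of_nonneg_right ?_ h1'
          rw [div_eq_mul_inv, ← tsum_geometric_of_lt_one hr.1.le hr.2]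
          exact mul_le_mul_of_nonneg_left ((summable_geometric_of_lt_one hr.1.le hr.2).sum_le_tsum
            _ fun k _ => pow_nonneg hr.1.le k) hc.le

end LinearAlgebra

/-! ### The map `S ↦ E[Nᵀ S N]` -/

section SecondMoments

open scoped MatrixOrder

variable {Ω ι κ l : Type*} {mΩ : MeasurableSpace Ω} {P : Measure Ω}

/-- All entries of the random matrix `N` are square integrable. -/
def MemL2 (P : Measure Ω) (N : Ω → Matrix ι κ ℝ) : Prop :=
  ∀ i j, MemLp (fun ω => N ω i j) 2 P

theorem MemL2.integrable_mul {N : Ω → Matrix ι κ ℝ} (hN : MemL2 P N) (i j a b) :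
    Integrable (fun ω => N ω i a * N ω j b) P :=
  MemLp.integrable_mul (hN i a) (hN j b)

theorem MemL2.add {M N : Ω → Matrix ι κ ℝ} (hM : MemL2 P M) (hN : MemL2 P N) :
    MemL2 P fun ω => M ω + N ω :=
  fun i j => (hM i j).add (hN i j)

theorem MemL2.const [IsFiniteMeasure P] (M : Matrix ι κ ℝ) : MemL2 P fun _ => M :=
  fun _ _ => memLp_const _

theorem MemL2.mul_const [Fintype κ] {M : Ω → Matrix ι κ ℝ} (hM : MemL2 P M) (F : Matrix κ l ℝ) :
    MemL2 P fun ω => M ω * F := fun i j => by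
  simp only [Matrix.mul_apply]
  exact memLp_finsetSum _ fun k _ => (hM i k).mul_const (F k j)

variable [Fintype ι]

/-- The map `S ↦ E[Nᵀ S N]`, written in terms of the second moments of the entries of `N`. -/
def quad (P : Measure Ω) (N : Ω → Matrix ι κ ℝ) : Matrix ι ι ℝ →ₗ[ℝ] Matrix κ κ ℝ where
  toFun S := Matrix.of fun a b => ∑ i, ∑ j, S i j * ∫ ω, N ω i a * N ω j b ∂P
  map_add' S T := by
    ext a b
    simp [add_mul, Finset.sum_add_distrib]
  map_smul' c S := by
    ext a b
    simp [Finset.mul_sum, mul_assoc]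

theorem quad_apply (N : Ω → Matrix ι κ ℝ) (S : Matrix ι ι ℝ) (a b : κ) :
    quad P N S a b = ∑ i, ∑ j, S i j * ∫ ω, N ω i a * N ω j b ∂P := rfl

theorem transpose_mul_mul_apply (N : Matrix ι κ ℝ) (S : Matrix ι ι ℝ) (a b : κ) :
    (Nᵀ * S * N) a b = ∑ i, ∑ j, S i j * (N i a * N j b) := by
  simp only [Matrix.mul_apply, Matrix.transpose_apply, Finset.sum_mul]
  rw [Finset.sum_comm]
  exact Finset.sum_congr rfl fun i _ => Finset.sum_congr rfl fun j _ => by ring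

theorem MemL2.integrable_quad {N : Ω → Matrix ι κ ℝ} (hN : MemL2 P N) (S : Matrix ι ι ℝ) (a b) :
    Integrable (fun ω => ((N ω)ᵀ * S * N ω) a b) P := by
  simp only [transpose_mul_mul_apply]
  exact integrable_finsetSum _ fun i _ => integrable_finsetSum _ fun j _ =>
    (hN.integrable_mul i j a b).const_mul _

/-- Defining `quad` by moments makes it linear unconditionally; square integrability is what
identifies it with an expectation. -/
theorem quad_apply_eq_integral {N : Ω → Matrix ι κ ℝ} (hN : MemL2 P N) (S : Matrix ι ι ℝ) (a b) :
    quad P N S a b = ∫ ω, ((N ω)ᵀ * S * N ω) a b ∂P := by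
  simp only [transpose_mul_mul_apply, quad_apply]
  have hi : ∀ i j, Integrable (fun ω => S i j * (N ω i a * N ω j b)) P := fun i j =>
    (hN.integrable_mul i j a b).const_mul _
  rw [integral_finsetSum _ fun i _ => integrable_finsetSum _ fun j _ => hi i j]
  refine Finset.sum_congr rfl fun i _ => ?_
  rw [integral_finsetSum _ fun j _ => hi i j]
  exact Finset.sum_congr rfl fun j _ => (integral_const_mul _ _).symm

theorem quad_eq_expect {N : Ω → Matrix ι κ ℝ} (hN : MemL2 P N) (S : Matrix ι ι ℝ) :
    quad P N S = expect P fun ω => (N ω)ᵀ * S * N ω := by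
  ext a b
  exact quad_apply_eq_integral hN S a b

theorem trace_quad [Fintype κ] {N : Ω → Matrix ι κ ℝ} (hN : MemL2 P N) (S : Matrix ι ι ℝ) :
    (quad P N S).trace = ∫ ω, ((N ω)ᵀ * S * N ω).trace ∂P := by
  simp only [Matrix.trace, Matrix.diag_apply]
  rw [integral_finsetSum _ fun a _ => hN.integrable_quad S a a]
  exact Finset.sum_congr rfl fun a _ => quad_apply_eq_integral hN S a a

theorem dotProduct_quad_mulVec [Fintype κ] {N : Ω → Matrix ι κ ℝ} (hN : MemL2 P N)
    (S : Matrix ι ι ℝ) (x : κ → ℝ) :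
    x ⬝ᵥ (quad P N S *ᵥ x) = ∫ ω, (N ω *ᵥ x) ⬝ᵥ (S *ᵥ (N ω *ᵥ x)) ∂P := by
  have h : ∀ ω, (N ω *ᵥ x) ⬝ᵥ (S *ᵥ (N ω *ᵥ x))
      = ∑ a, ∑ b, x a * (((N ω)ᵀ * S * N ω) a b * x b) := fun ω => by
    have : (N ω *ᵥ x) ⬝ᵥ (S *ᵥ (N ω *ᵥ x)) = x ⬝ᵥ (((N ω)ᵀ * S * N ω) *ᵥ x) := by
      rw [← Matrix.mulVec_mulVec, ← Matrix.mulVec_mulVec, Matrix.dotProduct_mulVec x,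
        Matrix.vecMul_transpose]
    rw [this]
    simp only [dotProduct, Matrix.mulVec, Finset.mul_sum]
  simp only [h]
  have hi : ∀ a b, Integrable (fun ω => x a * (((N ω)ᵀ * S * N ω) a b * x b)) P := fun a b =>
    ((hN.integrable_quad S a b).mul_const _).const_mul _
  rw [integral_finsetSum _ fun a _ => integrable_finsetSum _ fun b _ => hi a b]
  simp only [dotProduct, Matrix.mulVec, Finset.mul_sum]
  refine Finset.sum_congr rfl fun a _ => ?_
  rw [integral_finsetSum _ fun b _ => hi a b]
  refine Finset.sum_congr rfl fun b _ => ?_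
  rw [integral_const_mul, integral_mul_const, quad_apply_eq_integral hN]

theorem quad_nonneg [Fintype κ] {N : Ω → Matrix ι κ ℝ} (hN : MemL2 P N) (S : Matrix ι ι ℝ)
    (hS : 0 ≤ S) : 0 ≤ quad P N S := by
  rw [Matrix.nonneg_iff_posSemidef] at hS ⊢
  rw [Matrix.posSemidef_iff_dotProduct_mulVec]
  refine ⟨?_, fun x => ?_⟩
  · ext a b
    simp only [Matrix.conjTranspose_apply, star_trivial, quad_apply]
    rw [Finset.sum_comm]
    refine Finset.sum_congr rfl fun i _ => Finset.sum_congr rfl fun j _ => ?_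
    have : S j i = S i j := by simpa using hS.1.apply i j
    rw [this]
    simp only [mul_comm]
  · rw [star_trivial, dotProduct_quad_mulVec hN]
    exact integral_nonneg fun ω => by simpa using hS.dotProduct_mulVec_nonneg (N ω *ᵥ x)

end SecondMoments

/-! ### Products of independent random matrices -/

section Independence

variable {Ω ι κ l : Type*} {mΩ : MeasurableSpace Ω} {P : Measure Ω}

/-- Coefficients are Borel only on the support, so they are measurable only up to null sets;
independence is transferred through measurable representatives. -/
theorem indepFun_of_indep_of_aestronglyMeasurable {m₁ m₂ : MeasurableSpace Ω}
    (h : Indep m₁ m₂ P) {f g : Ω → ℝ} (hf : AEStronglyMeasurable[m₁] f P)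
    (hg : AEStronglyMeasurable[m₂] g P) : f ⟂ᵢ[P] g := by
  have h1 : IndepFun (hf.mk f) (hg.mk g) P := by
    rw [IndepFun_iff_Indep]
    exact indep_of_indep_of_le_left (indep_of_indep_of_le_right h
      hg.stronglyMeasurable_mk.measurable.comap_le) hf.stronglyMeasurable_mk.measurable.comap_le
  exact h1.congr hf.ae_eq_mk.symm hg.ae_eq_mk.symm

theorem memLp_two_mul_of_indepFun {f g : Ω → ℝ} (hf : MemLp f 2 P)
    (hg : MemLp g 2 P) (h : f ⟂ᵢ[P] g) : MemLp (fun ω => f ω * g ω) 2 P := by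
  refine (memLp_two_iff_integrable_sq (hf.1.mul hg.1)).2 ?_
  have hm : Measurable fun x : ℝ => x ^ 2 := by fun_prop
  have := (h.comp hm hm).integrable_mul hf.integrable_sq hg.integrable_sq
  simpa [mul_pow, Function.comp_def] using! this

theorem aestronglyMeasurable_sum {α : Type*} {m : MeasurableSpace Ω} (s : Finset α)
    {f : α → Ω → ℝ} (hf : ∀ i, AEStronglyMeasurable[m] (f i) P) :
    AEStronglyMeasurable[m] (fun ω => ∑ i ∈ s, f i ω) P :=
  ⟨fun ω => ∑ i ∈ s, (hf i).mk (f i) ω,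
    Finset.stronglyMeasurable_fun_sum s fun i _ => (hf i).stronglyMeasurable_mk, by
      filter_upwards [(s.eventually_all).2 fun i _ => (hf i).ae_eq_mk] with ω hω
      exact Finset.sum_congr rfl hω⟩

/-- All entries of the random matrix `N` are almost everywhere equal to `m`-measurable functions. -/
def AEMeas {Ω ι κ : Type*} (m : MeasurableSpace Ω) {mΩ : MeasurableSpace Ω} (P : Measure Ω)
    (N : Ω → Matrix ι κ ℝ) : Prop :=
  ∀ i j, AEStronglyMeasurable[m] (fun ω => N ω i j) P

variable [Fintype κ] {m₁ m₂ : MeasurableSpace Ω} {N : Ω → Matrix ι κ ℝ} {M : Ω → Matrix κ l ℝ}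

theorem AEMeas.mul {m : MeasurableSpace Ω} (hN : AEMeas m P N) (hM : AEMeas m P M) :
    AEMeas m P fun ω => N ω * M ω := fun i j => by
  simp only [Matrix.mul_apply]
  exact aestronglyMeasurable_sum _ fun k => (hN i k).mul (hM k j)

theorem MemL2.mul_of_indep (h : Indep m₁ m₂ P) (hN : MemL2 P N) (hM : MemL2 P M)
    (hN' : AEMeas m₁ P N) (hM' : AEMeas m₂ P M) : MemL2 P fun ω => N ω * M ω := fun i j => by
  simp only [Matrix.mul_apply]
  exact memLp_finsetSum _ fun k _ => memLp_two_mul_of_indepFun (hN i k) (hM k j)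
    (indepFun_of_indep_of_aestronglyMeasurable h (hN' i k) (hM' k j))

/-- Averaging over `N` first: `E[Mᵀ Nᵀ S N M] = E[Mᵀ E[Nᵀ S N] M]`, checked entrywise by factoring
expectations of products. -/
theorem quad_mul_of_indep [Fintype ι] (h : Indep m₁ m₂ P) (hN : MemL2 P N) (hM : MemL2 P M)
    (hN' : AEMeas m₁ P N) (hM' : AEMeas m₂ P M) (S : Matrix ι ι ℝ) :
    quad P (fun ω => N ω * M ω) S = quad P M (quad P N S) := by
  ext a b
  have hin : ∀ c d, IndepFun (fun ω => ((N ω)ᵀ * S * N ω) c d) (fun ω => M ω c a * M ω d b) P := by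
    intro c d
    refine indepFun_of_indep_of_aestronglyMeasurable h ?_ ((hM' c a).mul (hM' d b))
    simp only [transpose_mul_mul_apply]
    exact aestronglyMeasurable_sum _ fun i => aestronglyMeasurable_sum _ fun j =>
      ((hN' i c).mul (hN' j d)).const_mul _
  have hint : ∀ c d, Integrable
      (fun ω => ((N ω)ᵀ * S * N ω) c d * (M ω c a * M ω d b)) P := fun c d =>
    (hin c d).integrable_mul (hN.integrable_quad S c d) (hM.integrable_mul c d a b)
  rw [quad_apply_eq_integral (MemL2.mul_of_indep h hN hM hN' hM'), quad_apply]
  have e : ∀ ω, ((N ω * M ω)ᵀ * S * (N ω * M ω)) a b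
      = ∑ c, ∑ d, ((N ω)ᵀ * S * N ω) c d * (M ω c a * M ω d b) := fun ω => by
    rw [← transpose_mul_mul_apply, Matrix.transpose_mul]
    simp only [Matrix.mul_assoc]
  simp only [e]
  rw [integral_finsetSum _ fun c _ => integrable_finsetSum _ fun d _ => hint c d]
  refine Finset.sum_congr rfl fun c _ => ?_
  rw [integral_finsetSum _ fun d _ => hint c d]
  refine Finset.sum_congr rfl fun d _ => ?_
  rw [quad_apply_eq_integral hN]
  exact (hin c d).integral_fun_mul_eq_mul_integral (hN.integrable_quad S c d).1
    (hM.integrable_mul c d a b).1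

end Independence

/-! ### Moments of the state and of the impulse response -/

section System

variable {Ω ι κ l : Type*} [mΩ : MeasurableSpace Ω] {P : Measure Ω} {Z n p q : ℕ}
  {ξ : ℕ → Ω → EuclideanSpace ℝ (Fin Z)}

/-- The support is closed and carries full measure, so measurability there is almost everywhere
measurability for the law. -/
theorem memL2_map {ξ₀ : Ω → EuclideanSpace ℝ (Fin Z)} (hξ₀ : Measurable ξ₀)
    {M : EuclideanSpace ℝ (Fin Z) → Matrix ι κ ℝ} (hb : IsBorelOnSupport P ξ₀ M)
    (hs : SqIntegrable P ξ₀ M) : MemL2 (P.map ξ₀) M := fun i j => by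
  have h1 : AEMeasurable (fun x => M x i j) (P.map ξ₀) := by
    have := aemeasurable_restrict_of_measurable_subtype (μ := P.map ξ₀)
      (f := fun x => M x i j)
      Measure.isClosed_support.measurableSet (hb i j)
    rwa [Measure.restrict_eq_self_of_ae_mem (s := (P.map ξ₀).support)
      Measure.support_mem_ae] at this
  refine (memLp_map_measure_iff h1.aestronglyMeasurable hξ₀.aemeasurable).2 ?_
  exact (memLp_two_iff_integrable_sq (h1.aestronglyMeasurable.comp_measurable hξ₀)).2 (hs i j)

namespace IsIID

theorem memL2_comp (hξ : IsIID P ξ) {M : EuclideanSpace ℝ (Fin Z) → Matrix ι κ ℝ}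
    (hM : MemL2 (P.map (ξ 0)) M) (k : ℕ) : MemL2 P fun ω => M (ξ k ω) := fun i j => by
  have h := hM i j
  rw [← (hξ.identDistrib k).map_eq] at h
  exact (memLp_map_measure_iff h.1 (hξ.measurable k).aemeasurable).1 h

theorem aeMeas_comp (hξ : IsIID P ξ) {M : EuclideanSpace ℝ (Fin Z) → Matrix ι κ ℝ}
    (hM : MemL2 (P.map (ξ 0)) M) (k : ℕ) :
    AEMeas (MeasurableSpace.comap (ξ k) inferInstance) P fun ω => M (ξ k ω) := fun i j => by
  have h := (hM i j).1
  rw [← (hξ.identDistrib k).map_eq] at h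
  exact ⟨h.mk _ ∘ ξ k, h.stronglyMeasurable_mk.comp_measurable (comap_measurable _),
    ae_of_ae_map (hξ.measurable k).aemeasurable h.ae_eq_mk⟩

theorem quad_comp [Fintype ι] (hξ : IsIID P ξ) {M : EuclideanSpace ℝ (Fin Z) → Matrix ι κ ℝ}
    (hM : MemL2 (P.map (ξ 0)) M) (k : ℕ) :
    quad P (fun ω => M (ξ k ω)) = quad (P.map (ξ 0)) M := by
  ext S a b
  simp only [quad_apply]
  refine Finset.sum_congr rfl fun i _ => Finset.sum_congr rfl fun j _ => ?_
  have h := (hM.integrable_mul i j a b).1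
  rw [← (hξ.identDistrib k).map_eq] at h ⊢
  rw [integral_map (hξ.measurable k).aemeasurable h]

end IsIID

/-- The σ-algebra generated by `ξ_i`, `i < k`. -/
@[reducible]
def past {Ω : Type*} (ξ : ℕ → Ω → EuclideanSpace ℝ (Fin Z)) (k : ℕ) : MeasurableSpace Ω :=
  ⨆ i ∈ Set.Iio k, MeasurableSpace.comap (ξ i) inferInstance

theorem comap_le_past {Ω : Type*} {ξ : ℕ → Ω → EuclideanSpace ℝ (Fin Z)}
    {i k : ℕ} (h : i < k) :
    MeasurableSpace.comap (ξ i) inferInstance ≤ past ξ k :=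
  le_iSup₂_of_le i h le_rfl

theorem past_mono {Ω : Type*} {ξ : ℕ → Ω → EuclideanSpace ℝ (Fin Z)}
    {j k : ℕ} (h : j ≤ k) : past ξ j ≤ past ξ k :=
  iSup₂_le fun _ hi => comap_le_past (lt_of_lt_of_le hi h)

theorem IsIID.indep_past (hξ : IsIID P ξ) (k : ℕ) :
    Indep (MeasurableSpace.comap (ξ k) inferInstance) (past ξ k) P := by
  have := indep_iSup_of_disjoint (fun i => (hξ.measurable i).comap_le) hξ.indep.iIndep
    (S := {k}) (T := Set.Iio k) (by simp)
  simpa [past] using! this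

namespace LinSys

/-- The coefficients of `G`, evaluated at `ξ_0`, are square integrable. -/
structure SqInt (G : LinSys Z n p q) (P : Measure Ω)
    (ξ : ℕ → Ω → EuclideanSpace ℝ (Fin Z)) : Prop where
  memL2_A : MemL2 (P.map (ξ 0)) G.A
  memL2_B : MemL2 (P.map (ξ 0)) G.B
  memL2_C : MemL2 (P.map (ξ 0)) G.C
  memL2_D : MemL2 (P.map (ξ 0)) G.D

theorem transition_self {Ω : Type*} {ξ : ℕ → Ω → EuclideanSpace ℝ (Fin Z)}
    (G : LinSys Z n p q) (k : ℕ) (ω : Ω) : G.transition ξ k k ω = 1 := by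
  cases k <;> simp [transition]

theorem transition_succ {Ω : Type*} {ξ : ℕ → Ω → EuclideanSpace ℝ (Fin Z)}
    (G : LinSys Z n p q) {j k : ℕ} (h : j ≤ k) (ω : Ω) :
    G.transition ξ j (k + 1) ω = G.A (ξ k ω) * G.transition ξ j k ω := by
  simp [transition, not_lt.2 h]

/-- One induction carries all three claims: square integrability and measurability in the past allow
the new factor `A(ξ_{j+t})` to be averaged out. It is used with `j = 0`, `M = 1` for the state and
`j = 1`, `M = B(ξ_0)` for the impulse response. -/
theorem transition_mul_props {G : LinSys Z n p q} (hξ : IsIID P ξ)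
    (hA : MemL2 (P.map (ξ 0)) G.A) {j : ℕ} {M : Ω → Matrix (Fin n) κ ℝ} (hM : MemL2 P M)
    (hM' : AEMeas (past ξ j) P M) (t : ℕ) :
    MemL2 P (fun ω => G.transition ξ j (j + t) ω * M ω) ∧
    AEMeas (past ξ (j + t)) P (fun ω => G.transition ξ j (j + t) ω * M ω) ∧
    ∀ S, quad P (fun ω => G.transition ξ j (j + t) ω * M ω) S
      = quad P M ((quad (P.map (ξ 0)) G.A ^ t) S) := by
  induction t with
  | zero => simpa [transition_self] using ⟨hM, hM'⟩
  | succ t ih =>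
    obtain ⟨h1, h2, h3⟩ := ih
    have e : (fun ω => G.transition ξ j (j + (t + 1)) ω * M ω)
        = fun ω => G.A (ξ (j + t) ω) * (G.transition ξ j (j + t) ω * M ω) := by
      ext1 ω
      rw [← add_assoc, transition_succ G (Nat.le_add_right j t), Matrix.mul_assoc]
    have hA1 := hξ.memL2_comp hA (j + t)
    have hA2 := hξ.aeMeas_comp hA (j + t)
    have hi := hξ.indep_past (j + t)
    rw [e]
    refine ⟨hA1.mul_of_indep hi h1 hA2 h2, AEMeas.mul ?_ ?_, fun S => ?_⟩
    · exact fun i k => (hA2 i k).mono (comap_le_past (by omega))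
    · exact fun i k => (h2 i k).mono (past_mono (by omega))
    · rw [quad_mul_of_indep hi hA1 h1 hA2 h2, h3, hξ.quad_comp hA, pow_succ,
        Module.End.mul_apply]

theorem state_zero_input {Ω : Type*} {ξ : ℕ → Ω → EuclideanSpace ℝ (Fin Z)}
    (G : LinSys Z n p q) (x0 : EuclideanSpace ℝ (Fin n)) (k : ℕ) (ω : Ω) :
    G.state ξ 0 x0 k ω = WithLp.toLp 2 (G.transition ξ 0 k ω *ᵥ x0.ofLp) := by
  induction k with
  | zero => simp [state, transition]
  | succ k ih => simp [state, ih, transition_succ G (Nat.zero_le k)]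

theorem integral_sq_norm_state [IsProbabilityMeasure P] {G : LinSys Z n p q} (hξ : IsIID P ξ)
    (hA : MemL2 (P.map (ξ 0)) G.A) (x0 : EuclideanSpace ℝ (Fin n)) (k : ℕ) :
    ∫ ω, ‖G.state ξ 0 x0 k ω‖ ^ 2 ∂P
      = x0.ofLp ⬝ᵥ ((quad (P.map (ξ 0)) G.A ^ k) 1 *ᵥ x0.ofLp) := by
  obtain ⟨h1, -, h3⟩ := transition_mul_props hξ hA (j := 0) (M := fun _ => 1)
    (MemL2.const (P := P) (1 : Matrix (Fin n) (Fin n) ℝ))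
    (fun _ _ => aestronglyMeasurable_const) k
  simp only [Matrix.mul_one, zero_add] at h1 h3
  have e : quad P (fun _ : Ω => (1 : Matrix (Fin n) (Fin n) ℝ)) = LinearMap.id := by
    ext S a b
    simp [quad_apply, Matrix.one_apply]
  rw [e] at h3
  rw [← LinearMap.id_apply (R := ℝ) ((quad (P.map (ξ 0)) G.A ^ k) 1), ← h3,
    dotProduct_quad_mulVec h1]
  refine integral_congr_ae (ae_of_all _ fun ω => ?_)
  simp only [state_zero_input, EuclideanSpace.norm_sq_eq, Matrix.one_mulVec, dotProduct,
    Real.norm_eq_abs, sq_abs]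
  exact Finset.sum_congr rfl fun i _ => sq _

theorem impulseSum_eq {G : LinSys Z n p q} (hξ : IsIID P ξ) (hG : G.SqInt P ξ) (K : ℕ) :
    G.impulseSum P ξ K = (quad (P.map (ξ 0)) G.D 1
      + quad (P.map (ξ 0)) G.B (∑ k ∈ Finset.range K,
          (quad (P.map (ξ 0)) G.A ^ k) (quad (P.map (ξ 0)) G.C 1))).trace := by
  rw [impulseSum, Matrix.trace_add, map_sum, Matrix.trace_sum]
  congr 1
  · rw [← hξ.quad_comp hG.memL2_D 0, trace_quad (hξ.memL2_comp hG.memL2_D 0)]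
    simp
  · rw [← Finset.Ico_add_one_right_eq_Icc, Finset.sum_Ico_eq_sum_range]
    simp only [add_tsub_cancel_right]
    -- With `k = 1 + t`, the transition from time `1` to `k` has `t` factors, and `C(ξ_k)` is
    -- independent of everything before it.
    refine Finset.sum_congr rfl fun t _ => ?_
    have hB1 := hξ.memL2_comp hG.memL2_B 0
    obtain ⟨h1, h2, h3⟩ := transition_mul_props hξ hG.memL2_A (j := 1) hB1
      (fun i k => (hξ.aeMeas_comp hG.memL2_B 0 i k).mono (comap_le_past (by omega))) t
    have hC1 := hξ.memL2_comp hG.memL2_C (1 + t)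
    have hC2 := hξ.aeMeas_comp hG.memL2_C (1 + t)
    have hi := hξ.indep_past (1 + t)
    rw [← hξ.quad_comp hG.memL2_B 0, ← h3, ← hξ.quad_comp hG.memL2_C (1 + t),
      ← quad_mul_of_indep hi hC1 h1 hC2 h2, trace_quad (hC1.mul_of_indep hi h1 hC2 h2)]
    simp only [Matrix.transpose_mul, Matrix.mul_one, Matrix.mul_assoc]

open scoped MatrixOrder

/-- Squaring the stability bound, with `c = a²` and `r = lam²`, gives an inequality of quadratic
forms in `x₀`. -/
theorem expStable_iff [IsProbabilityMeasure P] {G : LinSys Z n p q} (hξ : IsIID P ξ)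
    (hA : MemL2 (P.map (ξ 0)) G.A) :
    G.ExpStable P ξ ↔ ∃ c : ℝ, 0 < c ∧ ∃ r ∈ Set.Ioo (0 : ℝ) 1,
      ∀ k, (quad (P.map (ξ 0)) G.A ^ k) 1 ≤ (c * r ^ k) • 1 := by
  have h1 : (0 : Matrix (Fin n) (Fin n) ℝ) ≤ 1 := Matrix.PosSemidef.one.nonneg
  have key : ∀ (k : ℕ) (d : ℝ), (quad (P.map (ξ 0)) G.A ^ k) 1 ≤ d • 1 ↔
      ∀ x0 : EuclideanSpace ℝ (Fin n), ∫ ω, ‖G.state ξ 0 x0 k ω‖ ^ 2 ∂P ≤ d * ‖x0‖ ^ 2 := by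
    intro k d
    have hH := (Matrix.nonneg_iff_posSemidef.1 (pow_map_nonneg (quad_nonneg hA) k 1 h1)).isHermitian
    rw [Matrix.le_iff, Matrix.posSemidef_iff_dotProduct_mulVec]
    have hn : ∀ x0 : EuclideanSpace ℝ (Fin n), ‖x0‖ ^ 2 = x0.ofLp ⬝ᵥ x0.ofLp := fun x0 => by
      simp only [EuclideanSpace.norm_sq_eq, dotProduct, Real.norm_eq_abs, sq_abs]
      exact Finset.sum_congr rfl fun i _ => sq _
    simp only [integral_sq_norm_state hξ hA]
    simp only [hn, star_trivial, Matrix.sub_mulVec, dotProduct_sub,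
      smul_one_dotProduct, sub_nonneg]
    refine ⟨fun h x => h.2 x.ofLp, fun h =>
      ⟨(Matrix.isHermitian_one.smul (IsSelfAdjoint.all _)).sub hH, fun x => h (WithLp.toLp 2 x)⟩⟩
  simp only [key]
  constructor
  · rintro ⟨a, ha, lam, ⟨hl0, hl1⟩, h⟩
    refine ⟨a ^ 2, by positivity, lam ^ 2, ⟨by positivity, by nlinarith⟩, fun k x0 => ?_⟩
    have := (Real.sqrt_le_left (by positivity)).1 (h k x0)
    refine this.trans_eq ?_
    rw [← pow_mul, mul_comm 2 k, pow_mul]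
    ring
  · rintro ⟨c, hc, r, ⟨hr0, hr1⟩, h⟩
    refine ⟨√c, Real.sqrt_pos.2 hc, √r, ⟨Real.sqrt_pos.2 hr0, ?_⟩, fun k x0 => ?_⟩
    · rw [Real.sqrt_lt' one_pos]; simpa
    · rw [Real.sqrt_le_left (by positivity)]
      refine (h k x0).trans_eq ?_
      rw [mul_pow, mul_pow, Real.sq_sqrt hc.le, ← pow_mul, mul_comm k 2, pow_mul,
        Real.sq_sqrt hr0.le]
      ring

theorem trace_mono {m : Type*} [Fintype m] {S T : Matrix m m ℝ} (h : S ≤ T) :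
    S.trace ≤ T.trace := by
  have := (Matrix.le_iff.1 h).trace_nonneg
  rwa [Matrix.trace_sub, sub_nonneg] at this

/-- Forward, the slack in `s < γ²` pays for the `ε` in the truncated series. Backward, `V` bounds
the increasing sequence `s_K`, so its limit exists and stays below `γ²`. -/
theorem expStable_and_h2Norm_lt_iff [IsProbabilityMeasure P] {G : LinSys Z n p q}
    (hξ : IsIID P ξ) (hG : G.SqInt P ξ) {γ : ℝ} (hγ : 0 < γ) :
    (G.ExpStable P ξ ∧ ∃ v, G.HasH2Norm P ξ v ∧ v < γ) ↔
      ∃ V : Matrix (Fin n) (Fin n) ℝ, V.PosDef ∧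
        (V - quad (P.map (ξ 0)) G.A V - quad (P.map (ξ 0)) G.C 1).PosDef ∧
        (quad (P.map (ξ 0)) G.D 1 + quad (P.map (ξ 0)) G.B V).trace < γ ^ 2 := by
  rw [expStable_iff hξ hG.memL2_A]
  have hL := quad_nonneg hG.memL2_A
  have hQ : 0 ≤ quad (P.map (ξ 0)) G.C 1 :=
    quad_nonneg hG.memL2_C 1 Matrix.PosSemidef.one.nonneg
  have hB := quad_nonneg hG.memL2_B
  have hs := impulseSum_eq hξ hG
  set L := quad (P.map (ξ 0)) G.A
  set Q := quad (P.map (ξ 0)) G.C 1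
  set T := quad (P.map (ξ 0)) G.B
  set E := quad (P.map (ξ 0)) G.D 1
  have hmono : Monotone (G.impulseSum P ξ) := by
    refine monotone_nat_of_le_succ fun K => ?_
    rw [hs, hs, Finset.sum_range_succ, map_add, ← add_assoc, Matrix.trace_add (E + _)]
    have := (Matrix.nonneg_iff_posSemidef.1 (hB _ (pow_map_nonneg hL K _ hQ))).trace_nonneg
    linarith
  constructor
  · rintro ⟨⟨c, hc, r, hr, h⟩, v, ⟨s, hlim, rfl⟩, hv⟩
    rw [Real.sqrt_lt' hγ] at hv
    set d := c / (1 - r) * (T 1).trace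
    -- `ε * d` bounds the trace added by the perturbation; `|d| + 1` keeps the quotient meaningful
    -- when `d = 0`.
    obtain ⟨ε, hε, hε'⟩ : ∃ ε : ℝ, 0 < ε ∧ ε * d < γ ^ 2 - s := by
      refine ⟨(γ ^ 2 - s) / (|d| + 1), div_pos (by linarith) (by positivity), ?_⟩
      rw [div_mul_eq_mul_div, div_lt_iff₀ (by positivity)]
      exact mul_lt_mul_of_pos_left (by linarith [le_abs_self d]) (by linarith)
    obtain ⟨N, V, hV, hV1, hV2⟩ := exists_lyapunov_of_pow_le hL hc hr h hQ hε
    refine ⟨V, hV, hV1, ?_⟩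
    have h1 := trace_mono (monotone_of_map_nonneg hB hV2)
    rw [map_add, map_smul, Matrix.trace_add, Matrix.trace_smul, smul_eq_mul] at h1
    have h2 : G.impulseSum P ξ N ≤ s := hmono.ge_of_tendsto hlim N
    rw [hs, Matrix.trace_add] at h2
    rw [Matrix.trace_add]
    have h3 : ε * (c / (1 - r)) * (T 1).trace = ε * d := by ring
    linarith
  · rintro ⟨V, hV, hV1, hV2⟩
    have hV3 : (V - L V).PosDef := by
      have := hV1.add_posSemidef (Matrix.nonneg_iff_posSemidef.1 hQ)
      simpa using this
    refine ⟨exists_pow_le_of_lyapunov hL hV hV3, ?_⟩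
    have hle : L V + Q ≤ V := by
      have := hV1.posSemidef.nonneg
      rw [sub_sub] at this
      exact sub_nonneg.1 this
    have hbd : ∀ K, G.impulseSum P ξ K ≤ (E + T V).trace := fun K => by
      rw [hs]
      exact trace_mono (add_le_add_right (monotone_of_map_nonneg hB
        (sum_pow_le_of_lyapunov hL hV.posSemidef.nonneg hle K)) _)
    have hlim := tendsto_atTop_ciSup hmono ⟨_, Set.forall_mem_range.2 hbd⟩
    refine ⟨_, ⟨_, hlim, rfl⟩, ?_⟩
    rw [Real.sqrt_lt' hγ]
    exact (ciSup_le hbd).trans_lt hV2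

end LinSys

end System

/-! ### Second-moment factors and their restacking -/

section Factorization

open scoped MatrixOrder

variable {Ω ι κ l : Type*} [mΩ : MeasurableSpace Ω] {P : Measure Ω}

theorem expect_vecMulVec_eq_quad (v : Ω → ι → ℝ) :
    (expect P fun ω => Matrix.vecMulVec (v ω) (v ω))
      = quad P (fun ω => Matrix.replicateRow Unit (v ω)) 1 := by
  ext a b
  simp [expect, quad_apply, Matrix.vecMulVec_apply]

theorem exists_isFactor [Fintype ι] {v : Ω → ι → ℝ} (hv : ∀ i, MemLp (fun ω => v ω i) 2 P) :
    ∃ (m : ℕ) (K : Matrix (Fin m) ι ℝ), IsFactor P v K := by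
  classical
  have h : 0 ≤ expect P fun ω => Matrix.vecMulVec (v ω) (v ω) := by
    rw [expect_vecMulVec_eq_quad]
    exact quad_nonneg (fun _ i => hv i) 1 Matrix.PosSemidef.one.nonneg
  obtain ⟨B, hB⟩ := CStarAlgebra.nonneg_iff_eq_star_mul_self.1 h
  refine ⟨Fintype.card ι, B.submatrix (Fintype.equivFin ι).symm id, le_rfl, ?_⟩
  rw [hB, Matrix.transpose_submatrix, Matrix.submatrix_mul_equiv, Matrix.submatrix_id_id]
  rfl

theorem quad_const [IsProbabilityMeasure P] [Fintype κ] (T : Matrix κ l ℝ) (S : Matrix κ κ ℝ) :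
    quad P (fun _ : Ω => T) S = Tᵀ * S * T := by
  ext a b
  simp [quad_apply, transpose_mul_mul_apply]

theorem quad_mul_const [IsProbabilityMeasure P] [Fintype ι] [Fintype κ] {N : Ω → Matrix ι κ ℝ}
    (hN : MemL2 P N) (T : Matrix κ l ℝ) (S : Matrix ι ι ℝ) :
    quad P (fun ω => N ω * T) S = Tᵀ * quad P N S * T := by
  rw [← quad_const (P := P)]
  exact quad_mul_of_indep (indep_bot_right mΩ) hN (MemL2.const T) (fun i j => (hN i j).1)
    (fun _ _ => aestronglyMeasurable_const) S

/-- The entries of `Kᵀ * K` are the mixed moments of the entries of `N`. The identity factor of the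
Kronecker product contracts the row index of `K`, and `S` weights its blocks. -/
theorem restack_kronecker {m k r : ℕ} {K : Matrix (Fin r) (Fin m × Fin k) ℝ}
    {N : Ω → Matrix (Fin m) (Fin k) ℝ}
    (h : Kᵀ * K = expect P fun ω => Matrix.vecMulVec (row (N ω)) (row (N ω)))
    (S : Matrix (Fin m) (Fin m) ℝ) :
    (restack K)ᵀ * (S ⊗ₖ (1 : Matrix (Fin r) (Fin r) ℝ)) * restack K = quad P N S := by
  ext x y
  rw [transpose_mul_mul_apply, quad_apply]
  have h' : ∀ i j, ∑ a, K a (i, x) * K a (j, y) = ∫ ω, N ω i x * N ω j y ∂P := fun i j => by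
    simpa [Matrix.mul_apply, expect, Matrix.vecMulVec_apply, row] using
      congr_fun (congr_fun h (i, x)) (j, y)
  simp only [← h', Fintype.sum_prod_type, Matrix.kronecker_apply, Matrix.one_apply, restack,
    Matrix.of_apply, mul_ite, mul_one, mul_zero, ite_mul, zero_mul, Finset.sum_ite_eq,
    Finset.mem_univ, if_true, Finset.mul_sum]
  exact Finset.sum_congr rfl fun i _ => Finset.sum_comm

/-- Feedback acts linearly on the row vector: `row(A + B F) = [row A, row B] T` for a constant `T`.
Hence `GG * T` has the Gram matrix required for the closed loop. -/
theorem restack_feedback [IsProbabilityMeasure P] {m k u r : ℕ}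
    {GG : Matrix (Fin r) ((Fin m × Fin k) ⊕ (Fin m × Fin u)) ℝ}
    {A : Ω → Matrix (Fin m) (Fin k) ℝ} {B : Ω → Matrix (Fin m) (Fin u) ℝ}
    (hA : MemL2 P A) (hB : MemL2 P B)
    (h : IsFactor P (fun ω => Sum.elim (row (A ω)) (row (B ω))) GG)
    (F : Matrix (Fin u) (Fin k) ℝ) (S : Matrix (Fin m) (Fin m) ℝ) :
    (restack GG.toCols₁ + restack GG.toCols₂ * F)ᵀ * (S ⊗ₖ (1 : Matrix (Fin r) (Fin r) ℝ)) *
      (restack GG.toCols₁ + restack GG.toCols₂ * F) = quad P (fun ω => A ω + B ω * F) S := by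
  set T : Matrix ((Fin m × Fin k) ⊕ (Fin m × Fin u)) (Fin m × Fin k) ℝ :=
    Matrix.fromRows 1 ((1 : Matrix (Fin m) (Fin m) ℝ) ⊗ₖ F) with hT
  have e1 : restack GG.toCols₁ + restack GG.toCols₂ * F = restack (GG * T) := by
    ext ⟨i, a⟩ j
    simp [hT, restack, Matrix.mul_apply, Fintype.sum_sum_type, Fintype.sum_prod_type,
      Matrix.one_apply, Prod.ext_iff, ite_and]
  have e2 : ∀ ω, Matrix.replicateRow Unit (Sum.elim (row (A ω)) (row (B ω))) * T
      = Matrix.replicateRow Unit (row (A ω + B ω * F)) := fun ω => by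
    ext _ ⟨i, j⟩
    simp [hT, row, Matrix.mul_apply, Fintype.sum_sum_type, Fintype.sum_prod_type,
      Matrix.one_apply, Prod.ext_iff, ite_and]
  rw [e1]
  refine restack_kronecker ?_ S
  rw [expect_vecMulVec_eq_quad]
  simp only [← e2]
  rw [quad_mul_const, ← expect_vecMulVec_eq_quad, ← h.2, Matrix.transpose_mul]
  · simp only [Matrix.mul_assoc]
  · rintro _ (⟨i, j⟩ | ⟨i, j⟩)
    · exact hA i j
    · exact hB i j

end Factorization

/-! ### From Lyapunov inequalities to the LMIs -/

/-- The Schur complement of the lower right block is `X * (⋯) * X`, with the Lyapunov expression in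
`X⁻¹` inside; congruence by the invertible `X` removes the outer factors. -/
theorem posDef_lyapunov_block_iff {n a c : Type*} [Fintype n] [DecidableEq n] [Fintype a]
    [DecidableEq a] [Fintype c] [DecidableEq c] {X : Matrix n n ℝ} (hX : X.PosDef)
    (M : Matrix (n × a) n ℝ) (N : Matrix c n ℝ) :
    (Matrix.fromBlocks X (Matrix.fromCols (M * X)ᵀ (N * X)ᵀ) (Matrix.fromRows (M * X) (N * X))
      (Matrix.fromBlocks (X ⊗ₖ (1 : Matrix a a ℝ)) 0 0 (1 : Matrix c c ℝ))).PosDef ↔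
    (X⁻¹ - Mᵀ * (X⁻¹ ⊗ₖ (1 : Matrix a a ℝ)) * M - Nᵀ * N).PosDef := by
  have hXu : IsUnit X.det := (Matrix.isUnit_iff_isUnit_det X).1 hX.isUnit
  have hXt : Xᵀ = X := by simpa using hX.isHermitian.eq
  have hD : (Matrix.fromBlocks (X ⊗ₖ (1 : Matrix a a ℝ)) 0 0 (1 : Matrix c c ℝ)).PosDef := by
    have := (posDef_fromBlocks_iff_schur (X ⊗ₖ (1 : Matrix a a ℝ)) (0 : Matrix c (n × a) ℝ)
      Matrix.PosDef.one).2 (by simpa using hX.kronecker Matrix.PosDef.one)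
    simpa using this
  have hDi : (Matrix.fromBlocks (X ⊗ₖ (1 : Matrix a a ℝ)) 0 0 (1 : Matrix c c ℝ))⁻¹
      = Matrix.fromBlocks (X⁻¹ ⊗ₖ (1 : Matrix a a ℝ)) 0 0 1 := by
    refine Matrix.inv_eq_right_inv ?_
    rw [Matrix.fromBlocks_multiply, ← Matrix.mul_kronecker_mul, Matrix.mul_nonsing_inv _ hXu]
    simp
  rw [← Matrix.transpose_fromRows, posDef_fromBlocks_iff_schur _ _ hD, hDi]
  refine Iff.trans ?_ (Matrix.IsUnit.posDef_star_left_conjugate_iff hX.isUnit)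
  congr! 1
  rw [Matrix.star_eq_conjTranspose, hX.isHermitian.eq, Matrix.transpose_fromRows,
    Matrix.fromCols_mul_fromBlocks, Matrix.fromCols_mul_fromRows]
  simp only [Matrix.transpose_mul, hXt, Matrix.mul_zero, add_zero, zero_add, Matrix.mul_one,
    Matrix.mul_sub, Matrix.sub_mul, Matrix.mul_nonsing_inv _ hXu, Matrix.one_mul,
    Matrix.mul_assoc, sub_sub, Matrix.mul_add, Matrix.add_mul]

namespace Plant

open scoped MatrixOrder

variable {Ω : Type*} [MeasurableSpace Ω] {Z n pw pu qz : ℕ} {G : Plant Z n pw pu qz}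
  {P : Measure Ω} {ξ : ℕ → Ω → EuclideanSpace ℝ (Fin Z)}

theorem Admissible.sqInt_closedLoop (hG : G.Admissible P ξ) (hξ : IsIID P ξ)
    (F : Matrix (Fin pu) (Fin n) ℝ) : (G.closedLoop F).SqInt P ξ where
  memL2_A := (memL2_map (hξ.measurable 0) hG.borel_A hG.sq_A).add
    ((memL2_map (hξ.measurable 0) hG.borel_Bu hG.sq_Bu).mul_const F)
  memL2_B := memL2_map (hξ.measurable 0) hG.borel_Bw hG.sq_Bw
  memL2_C := (memL2_map (hξ.measurable 0) hG.borel_C hG.sq_C).add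
    ((memL2_map (hξ.measurable 0) hG.borel_Du hG.sq_Du).mul_const F)
  memL2_D := memL2_map (hξ.measurable 0) hG.borel_Dw hG.sq_Dw

theorem memL2_eval {ι κ : Type*} (hξ : IsIID P ξ)
    {M : EuclideanSpace ℝ (Fin Z) → Matrix ι κ ℝ} (hb : IsBorelOnSupport P (ξ 0) M)
    (hs : SqIntegrable P (ξ 0) M) : MemL2 P fun ω => M (ξ 0 ω) :=
  hξ.memL2_comp (memL2_map (hξ.measurable 0) hb hs) 0

theorem Admissible.nonempty_factors (hG : G.Admissible P ξ) (hξ : IsIID P ξ) :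
    Nonempty (G.Factors P ξ) := by
  obtain ⟨nu, GAB, h1⟩ := exists_isFactor (P := P)
    (v := fun ω => Sum.elim (row (G.A (ξ 0 ω))) (row (G.Bu (ξ 0 ω)))) (by
      rintro (⟨i, j⟩ | ⟨i, j⟩)
      · exact memL2_eval hξ hG.borel_A hG.sq_A i j
      · exact memL2_eval hξ hG.borel_Bu hG.sq_Bu i j)
  obtain ⟨qzu, GCD, h2⟩ := exists_isFactor (P := P)
    (v := fun ω => Sum.elim (row (G.C (ξ 0 ω))) (row (G.Du (ξ 0 ω)))) (by
      rintro (⟨i, j⟩ | ⟨i, j⟩)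
      · exact memL2_eval hξ hG.borel_C hG.sq_C i j
      · exact memL2_eval hξ hG.borel_Du hG.sq_Du i j)
  obtain ⟨pwBar, BwBar, h3⟩ := exists_isFactor (P := P) (v := fun ω => row (G.Bw (ξ 0 ω)))
    fun ij => memL2_eval hξ hG.borel_Bw hG.sq_Bw ij.1 ij.2
  exact ⟨⟨nu, qzu, pwBar, GAB, GCD, BwBar, h1, h2, h3⟩⟩

theorem Admissible.ED_eq (hG : G.Admissible P ξ) (hξ : IsIID P ξ) :
    G.ED P ξ = quad (P.map (ξ 0)) G.Dw 1 := by
  rw [← hξ.quad_comp (memL2_map (hξ.measurable 0) hG.borel_Dw hG.sq_Dw) 0,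
    quad_eq_expect (memL2_eval hξ hG.borel_Dw hG.sq_Dw)]
  simp only [Matrix.mul_one, ED]

theorem Admissible.isGoodGain_iff [IsProbabilityMeasure P] (hG : G.Admissible P ξ)
    (hξ : IsIID P ξ) {γ : ℝ} (hγ : 0 < γ) (F : Matrix (Fin pu) (Fin n) ℝ) :
    G.IsGoodGain P ξ γ F ↔ ∃ V : Matrix (Fin n) (Fin n) ℝ, V.PosDef ∧
      (V - quad (P.map (ξ 0)) (G.closedLoop F).A V
        - quad (P.map (ξ 0)) (G.closedLoop F).C 1).PosDef ∧
      (G.ED P ξ + quad (P.map (ξ 0)) G.Bw V).trace < γ ^ 2 := by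
  rw [hG.ED_eq hξ]
  exact LinSys.expStable_and_h2Norm_lt_iff hξ (hG.sqInt_closedLoop hξ F) hγ

/-- With `Y = F * X`, the first block is the Lyapunov inequality for `V = X⁻¹`; the Schur complement
of the second is `R - (E_D + T V)`. -/
theorem Admissible.solvesLMI_iff [IsProbabilityMeasure P] (hG : G.Admissible P ξ)
    (hξ : IsIID P ξ) (φ : G.Factors P ξ) {γ : ℝ} {X : Matrix (Fin n) (Fin n) ℝ} (hX : X.PosDef)
    (F : Matrix (Fin pu) (Fin n) ℝ) (R : Matrix (Fin pw) (Fin pw) ℝ) :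
    φ.SolvesLMI γ X (F * X) R ↔ R.IsSymm ∧
      (X⁻¹ - quad (P.map (ξ 0)) (G.closedLoop F).A X⁻¹
        - quad (P.map (ξ 0)) (G.closedLoop F).C 1).PosDef ∧
      (R - (G.ED P ξ + quad (P.map (ξ 0)) G.Bw X⁻¹)).PosDef ∧ R.trace < γ ^ 2 := by
  have hA := restack_feedback (memL2_eval hξ hG.borel_A hG.sq_A) (memL2_eval hξ hG.borel_Bu hG.sq_Bu)
    φ.isFactor_GAB F X⁻¹
  have hC := restack_feedback (memL2_eval hξ hG.borel_C hG.sq_C) (memL2_eval hξ hG.borel_Du hG.sq_Du)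
    φ.isFactor_GCD F 1
  have hB := restack_kronecker φ.isFactor_BwBar.2 X⁻¹
  have hS := hG.sqInt_closedLoop hξ F
  have hA' := hξ.quad_comp hS.memL2_A 0
  have hC' := hξ.quad_comp hS.memL2_C 0
  have hB' := hξ.quad_comp hS.memL2_B 0
  simp only [closedLoop] at hA' hC' hB' ⊢
  rw [hA'] at hA
  rw [hC', Matrix.one_kronecker_one, Matrix.mul_one] at hC
  rw [hB'] at hB
  have e1 := posDef_lyapunov_block_iff hX (φ.ATilde + φ.BuTilde * F) (φ.CTilde + φ.DuTilde * F)
  rw [Factors.ATilde, Factors.BuTilde, Factors.CTilde, Factors.DuTilde, hA, hC] at e1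
  have hi : (X ⊗ₖ (1 : Matrix (Fin φ.pwBar) (Fin φ.pwBar) ℝ))⁻¹ = X⁻¹ ⊗ₖ 1 := by
    rw [Matrix.inv_kronecker, inv_one]
  have e2 := posDef_fromBlocks_iff_schur (R - G.ED P ξ) φ.BwTilde
    (hX.kronecker (Matrix.PosDef.one (n := Fin φ.pwBar)))
  rw [hi, sub_sub] at e2
  rw [Factors.BwTilde, hB] at e2
  rw [← e1, ← e2]
  simp only [Matrix.add_mul, Matrix.mul_assoc]
  exact ⟨fun h => ⟨h.symm_R, h.block₁, h.block₂, h.trace_R⟩,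
    fun h => ⟨hX, h.1, h.2.1, h.2.2.1, h.2.2.2⟩⟩

theorem Admissible.isGoodGain_of_solvesLMI [IsProbabilityMeasure P] (hG : G.Admissible P ξ)
    (hξ : IsIID P ξ) (φ : G.Factors P ξ) {γ : ℝ} (hγ : 0 < γ) {X : Matrix (Fin n) (Fin n) ℝ}
    {Y : Matrix (Fin pu) (Fin n) ℝ} {R : Matrix (Fin pw) (Fin pw) ℝ}
    (h : φ.SolvesLMI γ X Y R) : G.IsGoodGain P ξ γ (Y * X⁻¹) := by
  have hX := h.posDef_X
  have hY : Y = Y * X⁻¹ * X :=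
    (Matrix.nonsing_inv_mul_cancel_right X Y ((Matrix.isUnit_iff_isUnit_det X).1 hX.isUnit)).symm
  rw [hY, hG.solvesLMI_iff hξ φ hX] at h
  obtain ⟨-, h1, h2, h3⟩ := h
  rw [hG.isGoodGain_iff hξ hγ]
  refine ⟨X⁻¹, hX.inv, h1, ?_⟩
  have := h2.posSemidef.trace_nonneg
  rw [Matrix.trace_sub] at this
  linarith

theorem Admissible.exists_solvesLMI [IsProbabilityMeasure P] (hG : G.Admissible P ξ)
    (hξ : IsIID P ξ) (φ : G.Factors P ξ) {γ : ℝ} (hγ : 0 < γ) {F : Matrix (Fin pu) (Fin n) ℝ}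
    (h : G.IsGoodGain P ξ γ F) : ∃ (X : Matrix (Fin n) (Fin n) ℝ) (Y : Matrix (Fin pu) (Fin n) ℝ)
      (R : Matrix (Fin pw) (Fin pw) ℝ), φ.SolvesLMI γ X Y R := by
  obtain ⟨V, hV, h1, h2⟩ := (hG.isGoodGain_iff hξ hγ F).1 h
  set W := G.ED P ξ + quad (P.map (ξ 0)) G.Bw V with hW
  have hVV : V⁻¹⁻¹ = V :=
    Matrix.nonsing_inv_nonsing_inv V ((Matrix.isUnit_iff_isUnit_det V).1 hV.isUnit)
  -- Dividing by `pw + 1` covers `pw = 0` and leaves strict slack: `tr(W + δ • 1) = γ² - δ`.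
  set δ := (γ ^ 2 - W.trace) / (pw + 1) with hδ
  have hδ0 : 0 < δ := div_pos (by linarith) (by positivity)
  refine ⟨V⁻¹, F * V⁻¹, W + δ • 1, (hG.solvesLMI_iff hξ φ hV.inv F _).2 ?_⟩
  rw [hVV]
  refine ⟨?_, h1, ?_, ?_⟩
  · have h3 := quad_nonneg (hG.sqInt_closedLoop hξ F).memL2_D 1 Matrix.PosSemidef.one.nonneg
    have h4 := quad_nonneg (hG.sqInt_closedLoop hξ F).memL2_B V hV.posSemidef.nonneg
    have h5 : W.PosSemidef := by
      rw [hW, hG.ED_eq hξ]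
      exact (Matrix.nonneg_iff_posSemidef.1 h3).add (Matrix.nonneg_iff_posSemidef.1 h4)
    have h6 := (h5.add (Matrix.PosSemidef.one.smul hδ0.le)).isHermitian
    rwa [Matrix.IsHermitian, Matrix.conjTranspose_eq_transpose_of_trivial] at h6
  · rw [← hW, add_sub_cancel_left]
    exact Matrix.PosDef.one.smul hδ0
  · rw [Matrix.trace_add, Matrix.trace_smul, Matrix.trace_one, Fintype.card_fin, smul_eq_mul]
    have : δ * (pw + 1) = γ ^ 2 - W.trace := div_mul_cancel₀ _ (by positivity)
    linarith

end Plant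

end IIDH2

end

theorem theorem5 {Ω : Type*} [MeasurableSpace Ω] (P : Measure Ω) [IsProbabilityMeasure P]
    {Z n pw pu qz : ℕ} (ξ : ℕ → Ω → EuclideanSpace ℝ (Fin Z)) (hξ : IIDH2.IsIID P ξ)
    (G : IIDH2.Plant Z n pw pu qz) (hG : G.Admissible P ξ) (γ : ℝ) (hγ : 0 < γ) :
    Nonempty (G.Factors P ξ) ∧
    ∀ φ : G.Factors P ξ,
      ((∃ F : Matrix (Fin pu) (Fin n) ℝ, G.IsGoodGain P ξ γ F) ↔
        ∃ (X : Matrix (Fin n) (Fin n) ℝ) (Y : Matrix (Fin pu) (Fin n) ℝ)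
          (R : Matrix (Fin pw) (Fin pw) ℝ), φ.SolvesLMI γ X Y R) ∧
      ∀ (X : Matrix (Fin n) (Fin n) ℝ) (Y : Matrix (Fin pu) (Fin n) ℝ)
        (R : Matrix (Fin pw) (Fin pw) ℝ),
        φ.SolvesLMI γ X Y R → G.IsGoodGain P ξ γ (Y * X⁻¹) := by
  refine ⟨hG.nonempty_factors hξ, fun φ => ⟨⟨?_, ?_⟩, fun X Y R h =>
    hG.isGoodGain_of_solvesLMI hξ φ hγ h⟩⟩
  · rintro ⟨F, hF⟩
    exact hG.exists_solvesLMI hξ φ hγ hF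
  · rintro ⟨X, Y, R, h⟩
    exact ⟨_, hG.isGoodGain_of_solvesLMI hξ φ hγ h⟩
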